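/- Let $L\ge 1$ be an integer and let $H_L=\sum_{j=1}^{L-1}\bigl(|j\rangle\langle j+1|+|j+1\rangle\langle j|\bigr)$ be the adjacency matrix of the path with $L$ vertices labelled $1,2,\dots,L$, acting on $\mathbb{C}^L$ with orthonormal basis $|1\rangle,\dots,|L\rangle$. Let $t$ be a real number with $0\le t\le L/2$. If a system that evolves under the Hamiltonian $H_L$ with initial state $|1\rangle$ is measured at time $t$ in the basis $\{|j\rangle\}_{j=1}^{L}$, then the probability that the outcome $l$ satisfies $l>t$ is at least $1/3$; that is, $$\sum_{\substack{1\le l\le L\\ l>t}}\bigl|\langle l|e^{-iH_Lt}|1\rangle\bigr|^2\ \ge\ \frac13 .$$ -/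

import Mathlib

/-- The Hamiltonian of the quantum walk on a line with `L` vertices: the adjacency matrix of the
path graph. The index `j : Fin L` is the vertex labelled `j + 1`. -/
noncomputable def lineHamiltonian (L : ℕ) : Matrix (Fin L) (Fin L) ℂ :=
  open Classical in (SimpleGraph.pathGraph L).adjMatrix ℂ

theorem lineHamiltonian_apply (L : ℕ) (i j : Fin L) :
    lineHamiltonian L i j =
      if (i : ℕ) + 1 = (j : ℕ) ∨ (j : ℕ) + 1 = (i : ℕ) then 1 else 0 := by
  classical
  simp [lineHamiltonian, SimpleGraph.adjMatrix_apply, SimpleGraph.pathGraph_adj]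

/-- The state `exp (-i H t) ψ` at time `t` of a system with Hamiltonian `H` and initial state `ψ`. -/
noncomputable def evolvedState {n : ℕ} (H : Matrix (Fin n) (Fin n) ℂ) (t : ℝ) (ψ : Fin n → ℂ) :
    Fin n → ℂ :=
  Matrix.mulVec (NormedSpace.exp ((-(Complex.I * (t : ℂ))) • H)) ψ

/-- The basis state located at the vertex labelled `1`. -/
def firstVertexState (L : ℕ) (hL : 1 ≤ L) : Fin L → ℂ :=
  Pi.single ⟨0, hL⟩ 1

/-- The probability that measuring the (normalized) state `ψ` in the standard basis yields an
outcome in the event `E` (Born rule). -/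
noncomputable def measureProb {n : ℕ} (ψ : Fin n → ℂ) (E : Set (Fin n)) : ℝ :=
  open Classical in ∑ j : Fin n, if j ∈ E then ‖ψ j‖ ^ 2 else 0

/-!
The outcomes `l ≤ t` are shown to have probability at most `2 / 3`.

The sine modes `sin (p l)` with `p = π j / (L + 1)` diagonalize the Hamiltonian, with eigenvalues
`2 cos p`, and multiplication by `cos (α l)`, where `α = π k / (L + 1)`, maps the mode `p` to half
the sum of the modes `p ± α`. Hence the expectation of `cos (α l)` at time `t` is an explicit
average over `2 (L + 1)` equally spaced momenta (`sum_norm_sq_mul_cos`), namely twice the average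
over `q` of `(sin² q - s²) cos (4 t s sin q)` with `s = sin (α / 2)`. No reflected waves have to
be taken into account: the boundary enters only through the discreteness of `q`. Replacing the
cosine by Taylor-type bounds of low degree turns the average into averages of powers of `sin q`,
which are exact by orthogonality of the cosines on equally spaced angles.

For `t ≥ 2` choose `k` with `9 / 10 ≤ α t ≤ 9 / 5` (`exists_momentum_mul_mem`). The function
`1 + cos (α l)` is nonnegative and decreases up to `l = t`, so that by Markov's inequality the
probability of `l ≤ t` is at most the expectation of `1 + cos (α l)` divided by `1 + cos (α t)`;
that this is at most `2 / 3` is `one_add_sum_le_of_late`. This uses `t ≤ L / 2` in the choice of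
`k`, and in the form `L ≥ 4`, which makes the averages of `sin ^ 8` exact.

For `1 ≤ t < 2` the only outcome to exclude is `l = 1`, whose amplitude is real and is estimated
in the same way (`returnAmplitude_sq_le`). For `t < 1` there is nothing to exclude, and the total
probability is the case `k = 0` of the formula above.
-/

/-! ### Taylor bounds for the cosine -/

theorem nonneg_of_hasDerivAt_nonneg {f f' : ℝ → ℝ} (h : ∀ x, HasDerivAt f (f' x) x)
    (h0 : f 0 = 0) (hf' : ∀ x, 0 ≤ x → 0 ≤ f' x) (x : ℝ) (hx : 0 ≤ x) : 0 ≤ f x := by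
  have hmono : MonotoneOn f (Set.Ici 0) := by
    refine monotoneOn_of_deriv_nonneg (convex_Ici 0)
      (fun y _ => (h y).continuousAt.continuousWithinAt)
      (fun y _ => (h y).differentiableAt.differentiableWithinAt) fun y hy => ?_
    rw [(h y).deriv]
    exact hf' y (interior_subset hy)
  simpa [h0] using hmono (Set.mem_Ici.2 le_rfl) (Set.mem_Ici.2 hx) hx

theorem Real.cos_le_taylor_four (x : ℝ) : Real.cos x ≤ 1 - x ^ 2 / 2 + x ^ 4 / 24 := by
  wlog hx : 0 ≤ x generalizing x
  · simpa [Even.neg_pow (by decide : Even 4)] using this (-x) (by linarith)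
  have := nonneg_of_hasDerivAt_nonneg (f := fun x => 1 - x ^ 2 / 2 + x ^ 4 / 24 - Real.cos x)
    (f' := fun x => Real.sin x - (x - x ^ 3 / 6))
    (fun x => by
      refine HasDerivAt.congr_deriv (((((hasDerivAt_const x 1).sub
        ((hasDerivAt_pow 2 x).div_const 2)).add
        ((hasDerivAt_pow 4 x).div_const 24)).sub (Real.hasDerivAt_cos x))) ?_
      norm_num; ring)
    (by simp) (fun x hx => sub_nonneg.2 (Real.sin_ge_sub_cube hx)) x hx
  linarith

theorem Real.sin_le_taylor_five {x : ℝ} (hx : 0 ≤ x) :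
    Real.sin x ≤ x - x ^ 3 / 6 + x ^ 5 / 120 := by
  have := nonneg_of_hasDerivAt_nonneg (f := fun x => x - x ^ 3 / 6 + x ^ 5 / 120 - Real.sin x)
    (f' := fun x => 1 - x ^ 2 / 2 + x ^ 4 / 24 - Real.cos x)
    (fun x => by
      refine HasDerivAt.congr_deriv (((((hasDerivAt_id' x).sub
        ((hasDerivAt_pow 3 x).div_const 6)).add
        ((hasDerivAt_pow 5 x).div_const 120)).sub (Real.hasDerivAt_sin x))) ?_
      norm_num; ring)
    (by simp) (fun x _ => sub_nonneg.2 (Real.cos_le_taylor_four x)) x hx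
  linarith

theorem Real.taylor_six_le_cos (x : ℝ) :
    1 - x ^ 2 / 2 + x ^ 4 / 24 - x ^ 6 / 720 ≤ Real.cos x := by
  wlog hx : 0 ≤ x generalizing x
  · simpa [Even.neg_pow (by decide : Even 4), Even.neg_pow (by decide : Even 6)]
      using this (-x) (by linarith)
  have := nonneg_of_hasDerivAt_nonneg
    (f := fun x => Real.cos x - (1 - x ^ 2 / 2 + x ^ 4 / 24 - x ^ 6 / 720))
    (f' := fun x => x - x ^ 3 / 6 + x ^ 5 / 120 - Real.sin x)
    (fun x => by
      refine HasDerivAt.congr_deriv ((Real.hasDerivAt_cos x).sub ((((hasDerivAt_const x 1).sub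
        ((hasDerivAt_pow 2 x).div_const 2)).add
        ((hasDerivAt_pow 4 x).div_const 24)).sub ((hasDerivAt_pow 6 x).div_const 720))) ?_
      norm_num; ring)
    (by simp) (fun x hx => sub_nonneg.2 (Real.sin_le_taylor_five hx)) x hx
  linarith

theorem Real.taylor_seven_le_sin {x : ℝ} (hx : 0 ≤ x) :
    x - x ^ 3 / 6 + x ^ 5 / 120 - x ^ 7 / 5040 ≤ Real.sin x := by
  have := nonneg_of_hasDerivAt_nonneg
    (f := fun x => Real.sin x - (x - x ^ 3 / 6 + x ^ 5 / 120 - x ^ 7 / 5040))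
    (f' := fun x => Real.cos x - (1 - x ^ 2 / 2 + x ^ 4 / 24 - x ^ 6 / 720))
    (fun x => by
      refine HasDerivAt.congr_deriv ((Real.hasDerivAt_sin x).sub ((((hasDerivAt_id' x).sub
        ((hasDerivAt_pow 3 x).div_const 6)).add
        ((hasDerivAt_pow 5 x).div_const 120)).sub ((hasDerivAt_pow 7 x).div_const 5040))) ?_
      norm_num; ring)
    (by simp) (fun x _ => sub_nonneg.2 (Real.taylor_six_le_cos x)) x hx
  linarith

theorem Real.cos_le_taylor_eight (x : ℝ) :
    Real.cos x ≤ 1 - x ^ 2 / 2 + x ^ 4 / 24 - x ^ 6 / 720 + x ^ 8 / 40320 := by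
  wlog hx : 0 ≤ x generalizing x
  · simpa [Even.neg_pow (by decide : Even 4), Even.neg_pow (by decide : Even 6),
      Even.neg_pow (by decide : Even 8)] using this (-x) (by linarith)
  have := nonneg_of_hasDerivAt_nonneg
    (f := fun x => 1 - x ^ 2 / 2 + x ^ 4 / 24 - x ^ 6 / 720 + x ^ 8 / 40320 - Real.cos x)
    (f' := fun x => Real.sin x - (x - x ^ 3 / 6 + x ^ 5 / 120 - x ^ 7 / 5040))
    (fun x => by
      refine HasDerivAt.congr_deriv (((((((hasDerivAt_const x 1).sub
        ((hasDerivAt_pow 2 x).div_const 2)).add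
        ((hasDerivAt_pow 4 x).div_const 24)).sub ((hasDerivAt_pow 6 x).div_const 720)).add
        ((hasDerivAt_pow 8 x).div_const 40320)).sub (Real.hasDerivAt_cos x))) ?_
      norm_num; ring)
    (by simp) (fun x hx => sub_nonneg.2 (Real.taylor_seven_le_sin hx)) x hx
  linarith

/-- On `|y| ≤ 18 / 5` the degree-eight Taylor term is at most `(18 / 5) ^ 2 / 40320` times `y ^ 6`,
and `1067 / 10 ^ 6` is just below `1 / 720 - (18 / 5) ^ 2 / 40320`. This keeps the degree low enough
for the averages over momenta of short paths to be exact. -/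
theorem Real.cos_le_sextic {y : ℝ} (hy : y ^ 2 ≤ 324 / 25) :
    Real.cos y ≤ 1 - y ^ 2 / 2 + y ^ 4 / 24 - 1067 / 10 ^ 6 * y ^ 6 := by
  have h := Real.cos_le_taylor_eight y
  have h6 : 0 ≤ y ^ 6 := by positivity
  nlinarith [mul_le_mul_of_nonneg_left hy h6]

/-- A quadratic lower bound that, unlike `1 - y ^ 2 / 2`, is still useful for `y` near `2`. -/
theorem Real.half_sub_le_cos (y : ℝ) : 1 / 2 - y ^ 2 / 4 ≤ Real.cos y := by
  rcases le_or_gt (y ^ 2) 8 with hy | hy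
  · have h1 := Real.one_sub_sq_div_two_le_cos (x := y / 2)
    have h2 : Real.cos y = 2 * Real.cos (y / 2) ^ 2 - 1 := by
      rw [← Real.cos_two_mul]; ring_nf
    have h3 : 0 ≤ 1 - (y / 2) ^ 2 / 2 := by linarith
    nlinarith [pow_le_pow_left₀ h3 h1 2, sq_nonneg (y ^ 2 - 4)]
  · linarith [Real.neg_one_le_cos y]

/-! ### Averages over equally spaced angles -/

/-- A cosine of frequency `0 < m < 2 n` averages to zero over `2 n` equally spaced angles, whatever
the offset: the sum is the real part of a geometric sum of a nontrivial `2 n`-th root of unity. -/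
theorem sum_cos_equally_spaced {n m : ℕ} (hm : 0 < m) (hmn : m < 2 * n) (φ : ℝ) :
    ∑ j ∈ Finset.range (2 * n), Real.cos (m * (Real.pi * j / n) + φ) = 0 := by
  have hn : (n : ℝ) ≠ 0 := by
    have : n ≠ 0 := by omega
    exact_mod_cast this
  have hnC : (n : ℂ) ≠ 0 := by exact_mod_cast hn
  set x : ℂ := Complex.exp (m * (Real.pi / n) * Complex.I) with hx
  have hxn : x ^ (2 * n) = 1 := by
    rw [hx, ← Complex.exp_nat_mul, Complex.exp_eq_one_iff]
    refine ⟨m, ?_⟩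
    push_cast
    field_simp
  have hx1 : x ≠ 1 := by
    intro h
    rw [hx, Complex.exp_eq_one_iff] at h
    obtain ⟨k, hk⟩ := h
    have h1 : (m : ℂ) = k * (2 * n) := by
      have hpi : (Real.pi : ℂ) ≠ 0 := by exact_mod_cast Real.pi_ne_zero
      field_simp at hk
      linear_combination hk
    have h2 : (m : ℤ) = k * (2 * n) := by exact_mod_cast h1
    have h3 : 0 < k := by
      by_contra hk0
      have : k * (2 * (n : ℤ)) ≤ 0 := mul_nonpos_of_nonpos_of_nonneg (by omega) (by omega)
      omega
    have h4 : 1 * (2 * (n : ℤ)) ≤ k * (2 * n) := mul_le_mul_of_nonneg_right (by omega) (by omega)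
    omega
  have hgeom : ∑ j ∈ Finset.range (2 * n), x ^ j = 0 := by
    have h := geom_sum_mul x (2 * n)
    rw [hxn, sub_self] at h
    exact (mul_eq_zero.1 h).resolve_right (sub_ne_zero.2 hx1)
  have hterm : ∀ j : ℕ, Real.cos (m * (Real.pi * j / n) + φ)
      = (x ^ j * Complex.exp (φ * Complex.I)).re := by
    intro j
    rw [hx, ← Complex.exp_nat_mul, ← Complex.exp_add, ← Complex.exp_ofReal_mul_I_re]
    congr 2
    push_cast
    ring
  simp_rw [hterm]
  rw [← Complex.re_sum, ← Finset.sum_mul, hgeom]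
  simp

section SinPowers

variable {n : ℕ} (φ : ℝ)

theorem sum_const_equally_spaced (n : ℕ) (c : ℝ) :
    ∑ _j ∈ Finset.range (2 * n), c = 2 * n * c := by
  simp

theorem sum_sin_sq_equally_spaced (hn : 2 ≤ n) :
    ∑ j ∈ Finset.range (2 * n), Real.sin (Real.pi * j / n + φ) ^ 2 = 2 * n * (1 / 2) := by
  have h (q : ℝ) : Real.sin q ^ 2 = 1 / 2 - 1 / 2 * Real.cos (2 * q) := by
    rw [Real.cos_two_mul, Real.sin_sq]; ring
  have h2 := sum_cos_equally_spaced (n := n) (m := 2) (by norm_num) (by omega) (2 * φ)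
  push_cast at h2
  simp_rw [h, mul_add]
  rw [Finset.sum_sub_distrib, ← Finset.mul_sum, h2, sum_const_equally_spaced]
  ring

theorem Real.cos_four_mul (q : ℝ) : Real.cos (4 * q) = 2 * (2 * Real.cos q ^ 2 - 1) ^ 2 - 1 := by
  rw [show 4 * q = 2 * (2 * q) by ring, Real.cos_two_mul, Real.cos_two_mul]

theorem Real.cos_six_mul (q : ℝ) :
    Real.cos (6 * q) = 4 * (2 * Real.cos q ^ 2 - 1) ^ 3 - 3 * (2 * Real.cos q ^ 2 - 1) := by
  rw [show 6 * q = 3 * (2 * q) by ring, Real.cos_three_mul, Real.cos_two_mul]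

theorem Real.cos_eight_mul (q : ℝ) :
    Real.cos (8 * q) = 2 * (2 * (2 * Real.cos q ^ 2 - 1) ^ 2 - 1) ^ 2 - 1 := by
  rw [show 8 * q = 2 * (4 * q) by ring, Real.cos_two_mul, Real.cos_four_mul]

theorem sum_sin_pow_four_equally_spaced (hn : 3 ≤ n) :
    ∑ j ∈ Finset.range (2 * n), Real.sin (Real.pi * j / n + φ) ^ 4 = 2 * n * (3 / 8) := by
  have h (q : ℝ) : Real.sin q ^ 4
      = 3 / 8 - 1 / 2 * Real.cos (2 * q) + 1 / 8 * Real.cos (4 * q) := by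
    rw [Real.cos_four_mul, Real.cos_two_mul, Real.cos_sq']; ring
  have h2 := sum_cos_equally_spaced (n := n) (m := 2) (by norm_num) (by omega) (2 * φ)
  have h4 := sum_cos_equally_spaced (n := n) (m := 4) (by norm_num) (by omega) (4 * φ)
  push_cast at h2 h4
  simp_rw [h, mul_add]
  rw [Finset.sum_add_distrib, Finset.sum_sub_distrib, ← Finset.mul_sum, ← Finset.mul_sum, h2, h4,
    sum_const_equally_spaced]
  ring

theorem sum_sin_pow_six_equally_spaced (hn : 4 ≤ n) :
    ∑ j ∈ Finset.range (2 * n), Real.sin (Real.pi * j / n + φ) ^ 6 = 2 * n * (5 / 16) := by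
  have h (q : ℝ) : Real.sin q ^ 6 = 5 / 16 - 15 / 32 * Real.cos (2 * q)
      + 3 / 16 * Real.cos (4 * q) - 1 / 32 * Real.cos (6 * q) := by
    rw [Real.cos_six_mul, Real.cos_four_mul, Real.cos_two_mul, Real.cos_sq']; ring
  have h2 := sum_cos_equally_spaced (n := n) (m := 2) (by norm_num) (by omega) (2 * φ)
  have h4 := sum_cos_equally_spaced (n := n) (m := 4) (by norm_num) (by omega) (4 * φ)
  have h6 := sum_cos_equally_spaced (n := n) (m := 6) (by norm_num) (by omega) (6 * φ)
  push_cast at h2 h4 h6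
  simp_rw [h, mul_add]
  rw [Finset.sum_sub_distrib, Finset.sum_add_distrib, Finset.sum_sub_distrib, ← Finset.mul_sum,
    ← Finset.mul_sum, ← Finset.mul_sum, h2, h4, h6, sum_const_equally_spaced]
  ring

theorem sum_sin_pow_eight_equally_spaced (hn : 5 ≤ n) :
    ∑ j ∈ Finset.range (2 * n), Real.sin (Real.pi * j / n + φ) ^ 8 = 2 * n * (35 / 128) := by
  have h (q : ℝ) : Real.sin q ^ 8 = 35 / 128 - 7 / 16 * Real.cos (2 * q)
      + 7 / 32 * Real.cos (4 * q) - 1 / 16 * Real.cos (6 * q) + 1 / 128 * Real.cos (8 * q) := by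
    rw [Real.cos_eight_mul, Real.cos_six_mul, Real.cos_four_mul, Real.cos_two_mul, Real.cos_sq']
    ring
  have h2 := sum_cos_equally_spaced (n := n) (m := 2) (by norm_num) (by omega) (2 * φ)
  have h4 := sum_cos_equally_spaced (n := n) (m := 4) (by norm_num) (by omega) (4 * φ)
  have h6 := sum_cos_equally_spaced (n := n) (m := 6) (by norm_num) (by omega) (6 * φ)
  have h8 := sum_cos_equally_spaced (n := n) (m := 8) (by norm_num) (by omega) (8 * φ)
  push_cast at h2 h4 h6 h8
  simp_rw [h, mul_add]
  rw [Finset.sum_add_distrib, Finset.sum_sub_distrib, Finset.sum_add_distrib,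
    Finset.sum_sub_distrib, ← Finset.mul_sum, ← Finset.mul_sum, ← Finset.mul_sum,
    ← Finset.mul_sum, h2, h4, h6, h8, sum_const_equally_spaced]
  ring

end SinPowers

/-! ### Diagonalization of the path Hamiltonian by sine modes -/

open scoped Matrix.Norms.Operator in
/-- The exponential of a matrix acts on an eigenvector by the exponential of the eigenvalue. -/
theorem Matrix.exp_mulVec_of_eigenvector {n : ℕ} {A : Matrix (Fin n) (Fin n) ℂ} {v : Fin n → ℂ}
    {μ : ℂ} (h : A.mulVec v = μ • v) :
    (NormedSpace.exp A).mulVec v = Complex.exp μ • v := by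
  have hpow (k : ℕ) : (A ^ k).mulVec v = μ ^ k • v := by
    induction k with
    | zero => simp
    | succ k ih => rw [pow_succ, ← Matrix.mulVec_mulVec, h, Matrix.mulVec_smul, ih, smul_smul,
        pow_succ, mul_comm]
  have h1 := NormedSpace.exp_series_hasSum_exp' (𝕂 := ℂ) A
  let f : Matrix (Fin n) (Fin n) ℂ →+ (Fin n → ℂ) :=
    { toFun := fun M => M.mulVec v
      map_zero' := Matrix.zero_mulVec v
      map_add' := fun M N => Matrix.add_mulVec M N v }
  have hf : Continuous f := by
    change Continuous fun M : Matrix (Fin n) (Fin n) ℂ => M.mulVec v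
    exact continuous_id.matrix_mulVec continuous_const
  have h2 := h1.map f hf
  have h3 := (NormedSpace.exp_series_hasSum_exp' (𝕂 := ℂ) μ).smul_const v
  rw [← Complex.exp_eq_exp_ℂ] at h3
  refine h2.unique ?_
  convert h3 using 1
  ext1 k
  change Matrix.mulVec _ v = _
  rw [Matrix.smul_mulVec, hpow, smul_assoc]

/-- The vector with entries `sin (p l)`, where `l = 1, …, L` are the vertex labels. -/
noncomputable def sineMode (L : ℕ) (p : ℝ) : Fin L → ℂ :=
  fun l => (Real.sin (p * ((l : ℕ) + 1)) : ℂ)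

theorem lineHamiltonian_mulVec_sineMode {L : ℕ} {p : ℝ} (hp : Real.sin (p * (L + 1)) = 0) :
    (lineHamiltonian L).mulVec (sineMode L p) = (2 * Real.cos p : ℂ) • sineMode L p := by
  ext i
  let g : ℕ → ℂ := fun j => (Real.sin (p * (j + 1)) : ℂ)
  have hsplit (j : Fin L) : lineHamiltonian L i j * sineMode L p j
      = (if (i : ℕ) + 1 = (j : ℕ) then g j else 0)
        + (if (j : ℕ) + 1 = (i : ℕ) then g j else 0) := by
    rw [lineHamiltonian_apply]
    simp only [sineMode, g]
    split_ifs <;> first | omega | simp_all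
  have hup : ∑ j ∈ Finset.range L, (if (i : ℕ) + 1 = j then g j else 0)
      = (Real.sin (p * ((i : ℕ) + 1 + 1)) : ℂ) := by
    rw [Finset.sum_ite_eq]
    split_ifs with hi
    · simp [g]
    · have : (i : ℕ) + 1 = L := by have := i.2; simp at hi; omega
      have h' : ((i : ℕ) : ℝ) + 1 = L := by exact_mod_cast this
      rw [h', hp, Complex.ofReal_zero]
  have hdown : ∑ j ∈ Finset.range L, (if j + 1 = (i : ℕ) then g j else 0)
      = (Real.sin (p * (i : ℕ)) : ℂ) := by
    obtain ⟨m, hm⟩ := i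
    rcases m with _ | m
    · simp
    · simp only [add_left_inj]
      rw [Finset.sum_ite_eq', if_pos (by simp; omega)]
      simp [g]
  simp only [Matrix.mulVec, dotProduct, hsplit]
  rw [Finset.sum_add_distrib,
    Fin.sum_univ_eq_sum_range (fun j => if (i : ℕ) + 1 = j then g j else 0) L,
    Fin.sum_univ_eq_sum_range (fun j => if j + 1 = (i : ℕ) then g j else 0) L, hup, hdown]
  simp only [sineMode, Pi.smul_apply, smul_eq_mul]
  have hsum : Real.sin (p * ((i : ℕ) + 1 + 1)) + Real.sin (p * (i : ℕ))
      = 2 * Real.cos p * Real.sin (p * ((i : ℕ) + 1)) := by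
    rw [show p * ((i : ℕ) + 1 + 1) = p * ((i : ℕ) + 1) + p by ring,
      show p * ((i : ℕ) : ℝ) = p * ((i : ℕ) + 1) - p by ring, Real.sin_add, Real.sin_sub]
    ring
  exact_mod_cast hsum

/-- The momentum `π j / (L + 1)`, allowed by the two ends of the path. -/
noncomputable def momentum (L j : ℕ) : ℝ := Real.pi * j / (L + 1 : ℕ)

theorem sin_momentum_mul (L j : ℕ) : Real.sin (momentum L j * (L + 1)) = 0 := by
  have : momentum L j * (L + 1) = j * Real.pi := by
    unfold momentum; push_cast; field_simp
  rw [this, Real.sin_nat_mul_pi]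

theorem momentum_add (L j k : ℕ) : momentum L (j + k) = momentum L j + momentum L k := by
  unfold momentum; push_cast; ring

theorem momentum_two_mul (L : ℕ) : momentum L (2 * (L + 1)) = 2 * Real.pi := by
  unfold momentum; push_cast; field_simp

theorem exp_lineHamiltonian_mulVec_sineMode (L : ℕ) (z : ℂ) {p : ℝ}
    (hp : Real.sin (p * (L + 1)) = 0) :
    (NormedSpace.exp (z • lineHamiltonian L)).mulVec (sineMode L p)
      = Complex.exp (z * (2 * Real.cos p)) • sineMode L p := by
  apply Matrix.exp_mulVec_of_eigenvector
  rw [Matrix.smul_mulVec, lineHamiltonian_mulVec_sineMode hp, smul_smul]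

/-- Completeness of the sine modes, tested on the first vertex. Summation over all `2 (L + 1)`
momenta of a full period counts every mode twice. -/
theorem firstVertexState_eq_sum (L : ℕ) (hL : 1 ≤ L) :
    firstVertexState L hL = ∑ j ∈ Finset.range (2 * (L + 1)),
      ((1 / (L + 1) * Real.sin (momentum L j) : ℝ) : ℂ) • sineMode L (momentum L j) := by
  ext l
  simp only [Finset.sum_apply, Pi.smul_apply, smul_eq_mul, sineMode, ← Complex.ofReal_mul,
    ← Complex.ofReal_sum]
  have hprod (p : ℝ) : 1 / (L + 1 : ℝ) * Real.sin p * Real.sin (p * ((l : ℕ) + 1))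
      = 1 / (2 * (L + 1)) * (Real.cos ((l : ℕ) * p) - Real.cos ((l + 2 : ℕ) * p)) := by
    have h1 : ((l : ℕ) : ℝ) * p = p * ((l : ℕ) + 1) - p := by ring
    have h2 : ((l + 2 : ℕ) : ℝ) * p = p * ((l : ℕ) + 1) + p := by push_cast; ring
    rw [h1, h2, Real.cos_sub, Real.cos_add]
    field_simp
    ring
  simp_rw [hprod, ← Finset.mul_sum, Finset.sum_sub_distrib]
  have hl := l.2
  have h2 := sum_cos_equally_spaced (n := L + 1) (m := l + 2) (by omega) (by omega) 0
  simp only [add_zero] at h2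
  unfold momentum
  rw [h2]
  rcases Nat.eq_zero_or_pos (l : ℕ) with h0 | h0
  · have : l = ⟨0, hL⟩ := Fin.ext h0
    subst this
    simp [firstVertexState]
    field_simp
  · have h1 := sum_cos_equally_spaced (n := L + 1) (m := l) h0 (by omega) 0
    simp only [add_zero] at h1
    rw [h1]
    have : l ≠ ⟨0, hL⟩ := fun h => by simp [h] at h0
    simp [firstVertexState, this]

theorem evolvedState_firstVertexState (L : ℕ) (hL : 1 ≤ L) (t : ℝ) :
    evolvedState (lineHamiltonian L) t (firstVertexState L hL)
      = ∑ j ∈ Finset.range (2 * (L + 1)),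
        (((1 / (L + 1) * Real.sin (momentum L j) : ℝ) : ℂ)
          * Complex.exp (-(Complex.I * t) * (2 * Real.cos (momentum L j))))
          • sineMode L (momentum L j) := by
  rw [evolvedState, firstVertexState_eq_sum, Matrix.mulVec_sum]
  refine Finset.sum_congr rfl fun j _ => ?_
  rw [Matrix.mulVec_smul, exp_lineHamiltonian_mulVec_sineMode L _ (sin_momentum_mul L j), smul_smul]

theorem lineHamiltonian_isHermitian (L : ℕ) : (lineHamiltonian L).IsHermitian := by
  ext i j
  rw [Matrix.conjTranspose_apply, lineHamiltonian_apply, lineHamiltonian_apply]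
  simp only [or_comm]
  split_ifs <;> simp

/-- Expectations in the evolved state are computed by evolving backwards to the initial state. -/
theorem star_evolvedState_dotProduct (L : ℕ) (hL : 1 ≤ L) (t : ℝ) (φ : Fin L → ℂ) :
    star (evolvedState (lineHamiltonian L) t (firstVertexState L hL)) ⬝ᵥ φ
      = (NormedSpace.exp ((Complex.I * t) • lineHamiltonian L)).mulVec φ ⟨0, hL⟩ := by
  rw [evolvedState, Matrix.star_mulVec, ← Matrix.exp_conjTranspose, ← Matrix.dotProduct_mulVec,
    Matrix.conjTranspose_smul, (lineHamiltonian_isHermitian L).eq]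
  have h1 : star (-(Complex.I * (t : ℂ))) = Complex.I * t := by simp
  have h2 : star (firstVertexState L hL) = Pi.single ⟨0, hL⟩ 1 := by
    simp [firstVertexState]
  rw [h1, h2, single_dotProduct, one_mul]

theorem sum_range_periodic_add {M : Type*} [AddCommMonoid M] {N : ℕ} {f : ℕ → M}
    (hf : ∀ j, f (j + N) = f j) (k : ℕ) :
    ∑ j ∈ Finset.range N, f (j + k) = ∑ j ∈ Finset.range N, f j := by
  induction k with
  | zero => rfl
  | succ k ih =>
    rw [← ih]
    rcases N with _ | N
    · simp
    · rw [Finset.sum_range_succ, Finset.sum_range_succ' (fun j => f (j + k)), Nat.zero_add,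
        show N + (k + 1) = k + (N + 1) by ring, hf]
      simp_rw [add_right_comm _ 1 k, add_assoc]

/-- The expectation of `cos (α l)` after time `t`, for `α = π k / (L + 1)`. Multiplication by
`cos (α l)` shifts the momentum of a sine mode by `± α`, and `q = p + α / 2` is the midpoint of the
two momenta involved. -/
theorem sum_norm_sq_mul_cos (L : ℕ) (hL : 1 ≤ L) (t : ℝ) (k : ℕ) :
    ∑ l : Fin L, ‖evolvedState (lineHamiltonian L) t (firstVertexState L hL) l‖ ^ 2
        * Real.cos (momentum L k * ((l : ℕ) + 1))
      = 1 / (L + 1) * ∑ j ∈ Finset.range (2 * (L + 1)),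
        (Real.sin (momentum L j + momentum L k / 2) ^ 2 - Real.sin (momentum L k / 2) ^ 2)
          * Real.cos (4 * t * Real.sin (momentum L k / 2)
            * Real.sin (momentum L j + momentum L k / 2)) := by
  set ψ := evolvedState (lineHamiltonian L) t (firstVertexState L hL) with hψ
  set α := momentum L k with hα
  have hsinm (j : ℕ) : Real.sin ((momentum L j - α) * (L + 1)) = 0 := by
    have h1 := sin_momentum_mul L j
    have h2 := sin_momentum_mul L k
    rw [sub_mul, Real.sin_sub, h1, ← hα] at *
    rw [h2]; ring
  have hsinp (j : ℕ) : Real.sin ((momentum L j + α) * (L + 1)) = 0 := by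
    rw [hα, ← momentum_add]; exact sin_momentum_mul L _
  set φ : Fin L → ℂ := fun l => (Real.cos (α * ((l : ℕ) + 1)) : ℂ) * ψ l with hφ
  have hleft : ((∑ l : Fin L, ‖ψ l‖ ^ 2 * Real.cos (α * ((l : ℕ) + 1)) : ℝ) : ℂ)
      = star ψ ⬝ᵥ φ := by
    simp only [dotProduct, Complex.ofReal_sum, hφ, Pi.star_apply]
    refine Finset.sum_congr rfl fun l _ => ?_
    have : star (ψ l) * ψ l = ((‖ψ l‖ ^ 2 : ℝ) : ℂ) := by
      rw [Complex.star_def, Complex.conj_mul']; push_cast; rfl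
    rw [Complex.ofReal_mul, ← this]
    ring
  have hφsum : φ = ∑ j ∈ Finset.range (2 * (L + 1)),
      (((1 / (L + 1) * Real.sin (momentum L j) : ℝ) : ℂ)
        * Complex.exp (-(Complex.I * t) * (2 * Real.cos (momentum L j))) * (1 / 2))
        • (sineMode L (momentum L j + α) + sineMode L (momentum L j - α)) := by
    ext l
    simp only [hφ, hψ, evolvedState_firstVertexState, Finset.sum_apply, Pi.smul_apply,
      smul_eq_mul, Finset.mul_sum, Pi.add_apply]
    refine Finset.sum_congr rfl fun j _ => ?_
    have h : sineMode L (momentum L j + α) l + sineMode L (momentum L j - α) l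
        = 2 * (Real.cos (α * ((l : ℕ) + 1)) : ℂ) * sineMode L (momentum L j) l := by
      simp only [sineMode]
      norm_cast
      rw [add_mul, sub_mul, Real.sin_add, Real.sin_sub]
      ring
    rw [h]
    ring
  apply Complex.ofReal_injective
  rw [hleft, hψ, star_evolvedState_dotProduct, hφsum, Matrix.mulVec_sum]
  simp_rw [Matrix.mulVec_smul, Matrix.mulVec_add,
    exp_lineHamiltonian_mulVec_sineMode L _ (hsinp _),
    exp_lineHamiltonian_mulVec_sineMode L _ (hsinm _)]
  obtain ⟨N, hN⟩ : ∃ N, N = 2 * (L + 1) := ⟨_, rfl⟩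
  rw [← hN]
  simp only [Finset.sum_apply, Pi.smul_apply, Pi.add_apply, smul_eq_mul, mul_add]
  rw [Finset.sum_add_distrib]
  have hshift := sum_range_periodic_add (N := N) (f := fun j =>
    ((1 / (L + 1) * Real.sin (momentum L j) : ℝ) : ℂ)
        * Complex.exp (-(Complex.I * t) * (2 * Real.cos (momentum L j))) * (1 / 2)
        * (Complex.exp (Complex.I * t * (2 * Real.cos (momentum L j - α)))
          * sineMode L (momentum L j - α) ⟨0, hL⟩)) (by
      intro j
      have : momentum L j + 2 * Real.pi - α = momentum L j - α + 2 * Real.pi := by ring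
      simp [hN, sineMode, momentum_add, momentum_two_mul, this, -Complex.ofReal_sin,
        -Complex.ofReal_cos]) k
  rw [← hshift, ← Finset.sum_add_distrib]
  rw [Finset.mul_sum, Complex.ofReal_sum]
  refine Finset.sum_congr rfl fun j _ => ?_
  simp only [momentum_add, ← hα, add_sub_cancel_right, sineMode]
  set p := momentum L j
  have hcos : 4 * t * Real.sin (α / 2) * Real.sin (p + α / 2)
      = t * (2 * Real.cos p) - t * (2 * Real.cos (p + α)) := by
    have h1 : p = p + α / 2 - α / 2 := by ring
    have h2 : p + α = p + α / 2 + α / 2 := by ring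
    rw [h2]
    nth_rw 2 [h1]
    rw [Real.cos_add (p + α / 2), Real.cos_sub (p + α / 2)]
    ring
  have hsin : Real.sin (p + α / 2) ^ 2 - Real.sin (α / 2) ^ 2
      = Real.sin p * Real.sin (p + α) := by
    have h1 : p = p + α / 2 - α / 2 := by ring
    have h2 : p + α = p + α / 2 + α / 2 := by ring
    rw [h2]
    nth_rw 2 [h1]
    rw [Real.sin_add (p + α / 2), Real.sin_sub (p + α / 2)]
    nlinarith [Real.sin_sq_add_cos_sq (p + α / 2), Real.sin_sq_add_cos_sq (α / 2)]
  have h1 : Complex.exp (-(Complex.I * t) * (2 * Real.cos p))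
        * Complex.exp (Complex.I * t * (2 * Real.cos (p + α)))
      = Complex.exp (-((t * (2 * Real.cos p) - t * (2 * Real.cos (p + α)) : ℝ) : ℂ)
        * Complex.I) := by
    rw [← Complex.exp_add]
    congr 1
    push_cast
    ring
  have h2 : Complex.exp (-(Complex.I * t) * (2 * Real.cos (p + α)))
        * Complex.exp (Complex.I * t * (2 * Real.cos p))
      = Complex.exp (((t * (2 * Real.cos p) - t * (2 * Real.cos (p + α)) : ℝ) : ℂ)
        * Complex.I) := by
    rw [← Complex.exp_add]
    congr 1
    push_cast
    ring
  have h3 : ((Real.cos (t * (2 * Real.cos p) - t * (2 * Real.cos (p + α))) : ℝ) : ℂ)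
      = (Complex.exp (-(Complex.I * t) * (2 * Real.cos (p + α)))
          * Complex.exp (Complex.I * t * (2 * Real.cos p))
        + Complex.exp (-(Complex.I * t) * (2 * Real.cos p))
          * Complex.exp (Complex.I * t * (2 * Real.cos (p + α)))) / 2 := by
    rw [h1, h2, Complex.ofReal_cos, Complex.cos]
  rw [hcos, hsin]
  simp only [Nat.cast_zero, zero_add, mul_one, Complex.ofReal_mul]
  rw [h3]
  ring

/-! ### Bounds on averages of the propagator -/

/-- Upper bound for the average in `sum_norm_sq_mul_cos`, from a sextic majorant of the cosine where
the weight is `sin ^ 2` and the sixth Taylor polynomial where it is `- s ^ 2`. -/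
theorem average_sin_sq_mul_cos_le {n : ℕ} (hn : 5 ≤ n) (φ s z : ℝ) (hz : z ^ 2 ≤ 324 / 25) :
    1 / (n : ℝ) * ∑ j ∈ Finset.range (2 * n), (Real.sin (Real.pi * j / n + φ) ^ 2 - s ^ 2)
        * Real.cos (z * Real.sin (Real.pi * j / n + φ))
      ≤ 1 - 3 / 8 * z ^ 2 + 5 / 192 * z ^ 4 - 35 / 64 * (1067 / 10 ^ 6) * z ^ 6
        - 2 * s ^ 2 * (1 - z ^ 2 / 4 + z ^ 4 / 64 - z ^ 6 / 2304) := by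
  have hn0 : (0 : ℝ) < n := by exact_mod_cast (by omega : 0 < n)
  have hterm (x : ℝ) (hx : x ^ 2 ≤ 1) : (x ^ 2 - s ^ 2) * Real.cos (z * x)
      ≤ (- s ^ 2) + (1 + s ^ 2 * z ^ 2 / 2) * x ^ 2
        + (- z ^ 2 / 2 - s ^ 2 * z ^ 4 / 24) * x ^ 4
        + (z ^ 4 / 24 + s ^ 2 * z ^ 6 / 720) * x ^ 6 + (- (1067 / 10 ^ 6) * z ^ 6) * x ^ 8 := by
    have hzx : (z * x) ^ 2 ≤ 324 / 25 := by
      rw [mul_pow]; nlinarith [sq_nonneg z]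
    have h1 := mul_le_mul_of_nonneg_left (Real.cos_le_sextic hzx) (sq_nonneg x)
    have h2 := mul_le_mul_of_nonneg_left (Real.taylor_six_le_cos (z * x)) (sq_nonneg s)
    linarith
  have hsum := Finset.sum_le_sum fun j (_ : j ∈ Finset.range (2 * n)) =>
    hterm (Real.sin (Real.pi * j / n + φ)) (Real.sin_sq_le_one _)
  simp only [Finset.sum_add_distrib, ← Finset.mul_sum] at hsum
  rw [sum_const_equally_spaced, sum_sin_sq_equally_spaced φ (by omega),
    sum_sin_pow_four_equally_spaced φ (by omega), sum_sin_pow_six_equally_spaced φ (by omega),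
    sum_sin_pow_eight_equally_spaced φ hn] at hsum
  rw [one_div, inv_mul_le_iff₀ hn0]
  linarith

theorem sum_sin_sq_mul_cos_sq {n : ℕ} (hn : 3 ≤ n) :
    ∑ j ∈ Finset.range (2 * n), Real.sin (Real.pi * j / n) ^ 2 * Real.cos (Real.pi * j / n) ^ 2
      = 2 * n * (1 / 8) := by
  have h2 := sum_sin_sq_equally_spaced 0 (show 2 ≤ n by omega)
  have h4 := sum_sin_pow_four_equally_spaced 0 hn
  simp only [add_zero] at h2 h4
  simp_rw [Real.cos_sq', mul_sub, mul_one, ← pow_add]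
  rw [Finset.sum_sub_distrib, h2, h4]
  ring

/-- For `n = 3` the sixth harmonic does not average to zero, but its contribution has the right
sign. -/
theorem sum_sin_sq_mul_cos_pow_four_le {n : ℕ} (hn : 3 ≤ n) :
    ∑ j ∈ Finset.range (2 * n), Real.sin (Real.pi * j / n) ^ 2 * Real.cos (Real.pi * j / n) ^ 4
      ≤ 2 * n * (1 / 16) := by
  have h (q : ℝ) : Real.sin q ^ 2 * Real.cos q ^ 4 = 1 / 16 + 1 / 32 * Real.cos (2 * q)
      - 1 / 16 * Real.cos (4 * q) - 1 / 32 * Real.cos (6 * q) := by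
    rw [Real.cos_six_mul, Real.cos_four_mul, Real.cos_two_mul, Real.sin_sq]; ring
  have h2 := sum_cos_equally_spaced (n := n) (m := 2) (by norm_num) (by omega) 0
  have h4 := sum_cos_equally_spaced (n := n) (m := 4) (by norm_num) (by omega) 0
  have h6 : 0 ≤ ∑ j ∈ Finset.range (2 * n), Real.cos (6 * (Real.pi * j / n)) := by
    rcases hn.eq_or_lt with rfl | hn'
    · refine Finset.sum_nonneg fun j _ => ?_
      have : 6 * (Real.pi * j / (3 : ℕ)) = j * (2 * Real.pi) := by push_cast; ring
      rw [this, Real.cos_nat_mul_two_pi]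
      exact zero_le_one
    · have h6 := sum_cos_equally_spaced (n := n) (m := 6) (by norm_num) (by omega) 0
      push_cast at h6
      simp only [add_zero] at h6
      exact h6.ge
  push_cast at h2 h4
  simp only [add_zero] at h2 h4
  simp_rw [h]
  rw [Finset.sum_sub_distrib, Finset.sum_sub_distrib, Finset.sum_add_distrib, ← Finset.mul_sum,
    ← Finset.mul_sum, ← Finset.mul_sum, h2, h4, sum_const_equally_spaced]
  linarith

/-! ### Times between one and two -/

/-- The amplitude at time `t` of the initial vertex; by `evolvedState_first` it is real. -/
noncomputable def returnAmplitude (L : ℕ) (t : ℝ) : ℝ :=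
  1 / (L + 1 : ℕ) * ∑ j ∈ Finset.range (2 * (L + 1)),
    Real.sin (momentum L j) ^ 2 * Real.cos (2 * t * Real.cos (momentum L j))

theorem evolvedState_first (L : ℕ) (hL : 1 ≤ L) (t : ℝ) :
    evolvedState (lineHamiltonian L) t (firstVertexState L hL) ⟨0, hL⟩
      = (returnAmplitude L t : ℂ) := by
  rw [evolvedState_firstVertexState]
  -- The imaginary part changes sign under the shift `p ↦ p + π` of the summation variable.
  have hodd : ∑ j ∈ Finset.range (2 * (L + 1)),
      Real.sin (momentum L j) ^ 2 * Real.sin (2 * t * Real.cos (momentum L j)) = 0 := by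
    have hpi : momentum L (L + 1) = Real.pi := by unfold momentum; field_simp
    have h := sum_range_periodic_add (N := 2 * (L + 1)) (f := fun j =>
      Real.sin (momentum L j) ^ 2 * Real.sin (2 * t * Real.cos (momentum L j))) (by
        intro j; simp [momentum_add, momentum_two_mul]) (L + 1)
    simp only [momentum_add, hpi, Real.sin_add_pi, Real.cos_add_pi, mul_neg, Real.sin_neg, neg_sq,
      Finset.sum_neg_distrib] at h
    linarith
  have hterm (j : ℕ) : ((1 / (L + 1) * Real.sin (momentum L j) : ℝ) : ℂ)
        * Complex.exp (-(Complex.I * t) * (2 * Real.cos (momentum L j)))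
        * Real.sin (momentum L j)
      = ((1 / (L + 1 : ℕ) * (Real.sin (momentum L j) ^ 2
          * Real.cos (2 * t * Real.cos (momentum L j))) : ℝ) : ℂ)
        - ((1 / (L + 1 : ℕ) * (Real.sin (momentum L j) ^ 2
          * Real.sin (2 * t * Real.cos (momentum L j))) : ℝ) : ℂ) * Complex.I := by
    have : -(Complex.I * t) * (2 * Real.cos (momentum L j))
        = ((-(2 * t * Real.cos (momentum L j)) : ℝ) : ℂ) * Complex.I := by push_cast; ring
    rw [this, Complex.exp_mul_I, ← Complex.ofReal_cos, ← Complex.ofReal_sin, Real.cos_neg,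
      Real.sin_neg]
    push_cast
    ring
  simp only [Finset.sum_apply, Pi.smul_apply, smul_eq_mul, sineMode, Nat.cast_zero, zero_add,
    mul_one]
  simp_rw [hterm]
  rw [Finset.sum_sub_distrib, ← Finset.sum_mul, ← Complex.ofReal_sum, ← Complex.ofReal_sum,
    ← Finset.mul_sum, ← Finset.mul_sum, hodd]
  simp [returnAmplitude]

theorem half_sub_le_returnAmplitude {L : ℕ} (hL : 2 ≤ L) (t : ℝ) :
    1 / 2 - t ^ 2 / 4 ≤ returnAmplitude L t := by
  have hn0 : (0 : ℝ) < (L + 1 : ℕ) := by positivity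
  have h2 := sum_sin_sq_equally_spaced 0 (show 2 ≤ L + 1 by omega)
  have h22 := sum_sin_sq_mul_cos_sq (show 3 ≤ L + 1 by omega)
  simp only [add_zero] at h2
  have hterm (q : ℝ) : 1 / 2 * Real.sin q ^ 2 - t ^ 2 * (Real.sin q ^ 2 * Real.cos q ^ 2)
      ≤ Real.sin q ^ 2 * Real.cos (2 * t * Real.cos q) := by
    have := mul_le_mul_of_nonneg_left (Real.half_sub_le_cos (2 * t * Real.cos q))
      (sq_nonneg (Real.sin q))
    linarith
  have hsum := Finset.sum_le_sum fun j (_ : j ∈ Finset.range (2 * (L + 1))) =>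
    hterm (Real.pi * j / (L + 1 : ℕ))
  rw [Finset.sum_sub_distrib, ← Finset.mul_sum, ← Finset.mul_sum, h2, h22] at hsum
  unfold returnAmplitude momentum
  rw [one_div ((L + 1 : ℕ) : ℝ), le_inv_mul_iff₀ hn0]
  linarith

theorem returnAmplitude_le {L : ℕ} (hL : 2 ≤ L) (t : ℝ) :
    returnAmplitude L t ≤ 1 - t ^ 2 / 2 + t ^ 4 / 12 := by
  have hn0 : (0 : ℝ) < (L + 1 : ℕ) := by positivity
  have h2 := sum_sin_sq_equally_spaced 0 (show 2 ≤ L + 1 by omega)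
  have h22 := sum_sin_sq_mul_cos_sq (show 3 ≤ L + 1 by omega)
  have h24 := sum_sin_sq_mul_cos_pow_four_le (show 3 ≤ L + 1 by omega)
  simp only [add_zero] at h2
  have hterm (q : ℝ) : Real.sin q ^ 2 * Real.cos (2 * t * Real.cos q)
      ≤ Real.sin q ^ 2 - 2 * t ^ 2 * (Real.sin q ^ 2 * Real.cos q ^ 2)
        + 2 / 3 * t ^ 4 * (Real.sin q ^ 2 * Real.cos q ^ 4) := by
    have := mul_le_mul_of_nonneg_left (Real.cos_le_taylor_four (2 * t * Real.cos q))
      (sq_nonneg (Real.sin q))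
    linarith
  have hsum := Finset.sum_le_sum fun j (_ : j ∈ Finset.range (2 * (L + 1))) =>
    hterm (Real.pi * j / (L + 1 : ℕ))
  rw [Finset.sum_add_distrib, Finset.sum_sub_distrib, ← Finset.mul_sum, ← Finset.mul_sum, h2,
    h22] at hsum
  have h24' := mul_le_mul_of_nonneg_left h24 (show 0 ≤ 2 / 3 * t ^ 4 by positivity)
  unfold returnAmplitude momentum
  rw [one_div, inv_mul_le_iff₀ hn0]
  linarith

theorem returnAmplitude_sq_le {L : ℕ} (hL : 2 ≤ L) {t : ℝ} (h1 : 1 ≤ t) (h2 : t ≤ 2) :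
    returnAmplitude L t ^ 2 ≤ 2 / 3 := by
  have hlo := half_sub_le_returnAmplitude hL t
  have hup := returnAmplitude_le hL t
  have ht1 : 1 ≤ t ^ 2 := by nlinarith
  have ht4 : t ^ 2 ≤ 4 := by nlinarith
  have hup' : 1 - t ^ 2 / 2 + t ^ 4 / 12 ≤ 3 / 5 := by
    nlinarith [mul_nonneg (sub_nonneg.2 ht1) (sub_nonneg.2 ht4)]
  nlinarith

/-! ### Times from two on -/

/-- Polynomial form of the bound for late times `t`, with `α` the momentum of the test function
`1 + cos (α l)`: here `y = (α t) ^ 2 / 4`, `w = (t sin (α / 2)) ^ 2` and `τ = 1 / t ^ 2`. The left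
side bounds the expectation of the test function, the right side `2 / 3 * (1 + cos (α t))`.
Replacing `w` by `y` costs an error proportional to `τ`; what remains is linear in `τ`, so that it
suffices to consider `τ = 0` and `τ = 1 / 4`. -/
theorem late_time_polynomial {y w τ : ℝ} (hy : 81 / 400 ≤ y) (hy' : y ≤ 81 / 100) (hτ : 0 ≤ τ)
    (hτ' : τ ≤ 1 / 4) (hw : w ≤ y) (hw' : y - y ^ 2 * τ / 3 ≤ w) :
    2 - 6 * w + 20 / 3 * w ^ 2 - 2240 * (1067 / 10 ^ 6) * w ^ 3
        - 2 * τ * (w * (1 - 4 * w + 4 * w ^ 2 - 16 / 9 * w ^ 3))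
      ≤ 2 / 3 * (2 - 2 * y + 2 / 3 * y ^ 2 - 4 / 45 * y ^ 3) := by
  have hwy : 373 / 400 * y ≤ w := by nlinarith [mul_nonneg (by linarith : 0 ≤ y) hτ]
  have hw0 : 18 / 100 ≤ w := by linarith
  -- `w ↦ w (1 - 4 w + 4 w ^ 2 - 16 / 9 w ^ 3)` decreases on the relevant range.
  have hdec : y * (1 - 4 * y + 4 * y ^ 2 - 16 / 9 * y ^ 3)
      ≤ w * (1 - 4 * w + 4 * w ^ 2 - 16 / 9 * w ^ 3) := by
    have hq : 1 - 4 * (y + w) + 4 * (y ^ 2 + y * w + w ^ 2)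
        - 16 / 9 * (y ^ 2 + w ^ 2) * (y + w) ≤ 0 := by
      have hd : (y - w) ^ 2 ≤ 1 / 100 := by
        nlinarith [mul_nonneg (sub_nonneg.2 hw) (by linarith : 0 ≤ 1 / 10 - (y - w))]
      have hcubic : 1 - 4 * (y + w) + 3 * (y + w) ^ 2 - 8 / 9 * (y + w) ^ 3 ≤ -1 / 100 := by
        nlinarith [sq_nonneg (y + w - 9 / 8), mul_nonneg (by linarith : 0 ≤ y + w - 38 / 100)
          (sq_nonneg (y + w - 9 / 8))]
      have hmix : 0 ≤ (y - w) ^ 2 * (y + w) := mul_nonneg (sq_nonneg _) (by linarith)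
      linarith
    have := mul_nonneg (sub_nonneg.2 hw) (neg_nonneg.2 hq)
    linarith
  -- The difference quotient of the `τ`-free part is bounded by a quadratic in `y`.
  have hconv : 2 - 6 * w + 20 / 3 * w ^ 2 - 2240 * (1067 / 10 ^ 6) * w ^ 3
      ≤ 2 - 6 * y + 20 / 3 * y ^ 2 - 2240 * (1067 / 10 ^ 6) * y ^ 3
        + y ^ 2 * τ / 3 * (6 - 62 / 5 * y + 7171 / 1000 * y ^ 2) := by
    have hB : 6 - 20 / 3 * (w + y) + 2240 * (1067 / 10 ^ 6) * (w ^ 2 + w * y + y ^ 2)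
        ≤ 6 - 62 / 5 * y + 7171 / 1000 * y ^ 2 := by
      nlinarith [mul_nonneg (sub_nonneg.2 hw) (by linarith : 0 ≤ 2 * y + w)]
    have hB' : 0 ≤ 6 - 62 / 5 * y + 7171 / 1000 * y ^ 2 := by
      nlinarith [sq_nonneg (y - 864 / 1000)]
    have h1 := mul_le_mul_of_nonneg_left hB (sub_nonneg.2 hw)
    have h2 := mul_le_mul_of_nonneg_right (by linarith : y - w ≤ y ^ 2 * τ / 3) hB'
    linarith
  have hprod := mul_nonneg (sub_nonneg.2 hy) (sub_nonneg.2 hy')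
  have hend0 : 0 ≤ 2 / 3 * (2 - 2 * y + 2 / 3 * y ^ 2 - 4 / 45 * y ^ 3)
      - (2 - 6 * y + 20 / 3 * y ^ 2 - 2240 * (1067 / 10 ^ 6) * y ^ 3) := by
    nlinarith [hprod, mul_nonneg hprod (sub_nonneg.2 hy)]
  have hend1 : 0 ≤ 2 / 3 * (2 - 2 * y + 2 / 3 * y ^ 2 - 4 / 45 * y ^ 3)
      - (2 - 6 * y + 20 / 3 * y ^ 2 - 2240 * (1067 / 10 ^ 6) * y ^ 3)
      + 1 / 4 * (2 * (y * (1 - 4 * y + 4 * y ^ 2 - 16 / 9 * y ^ 3))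
        - y ^ 2 / 3 * (6 - 62 / 5 * y + 7171 / 1000 * y ^ 2)) := by
    nlinarith [hprod, mul_nonneg hprod (sub_nonneg.2 hy), mul_nonneg hprod (sq_nonneg y)]
  have hlin := add_nonneg (mul_nonneg (by linarith : 0 ≤ 1 - 4 * τ) hend0)
    (mul_nonneg (by linarith : 0 ≤ 4 * τ) hend1)
  have hdec' := mul_le_mul_of_nonneg_left hdec (by linarith : 0 ≤ 2 * τ)
  linarith

/-- For `t ≥ 2` and `9 / 10 ≤ α t ≤ 9 / 5`, the expectation of `1 + cos (α l)` is at most `2 / 3` of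
its value at `l = t`. -/
theorem one_add_sum_le_of_late {L k : ℕ} {t : ℝ} (hL : 4 ≤ L) (ht : 2 ≤ t)
    (hu : 9 / 10 ≤ momentum L k * t) (hu' : momentum L k * t ≤ 9 / 5) :
    1 + 1 / (L + 1 : ℝ) * ∑ j ∈ Finset.range (2 * (L + 1)),
        (Real.sin (momentum L j + momentum L k / 2) ^ 2 - Real.sin (momentum L k / 2) ^ 2)
          * Real.cos (4 * t * Real.sin (momentum L k / 2)
            * Real.sin (momentum L j + momentum L k / 2))
      ≤ 2 / 3 * (1 + Real.cos (momentum L k * t)) := by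
  set x := momentum L k / 2 with hx
  have hα : momentum L k = 2 * x := by rw [hx]; ring
  rw [hα] at hu hu' ⊢
  have ht0 : 0 < t := by linarith
  have hx0 : 0 < x := by
    by_contra h
    nlinarith [not_lt.1 h]
  have hx1 : x ≤ 9 / 20 := by
    by_contra h
    nlinarith [not_le.1 h]
  set s := Real.sin x with hs
  have hs_le : s ≤ x := Real.sin_le hx0.le
  have hs_ge : x - x ^ 3 / 6 ≤ s := Real.sin_ge_sub_cube hx0.le
  have hlin : 0 ≤ x - x ^ 3 / 6 := by
    have : x - x ^ 3 / 6 = x * (1 - x ^ 2 / 6) := by ring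
    rw [this]
    exact mul_nonneg hx0.le (by nlinarith)
  have hs0 : 0 ≤ s := hlin.trans hs_ge
  have hs2_le : s ^ 2 ≤ x ^ 2 := pow_le_pow_left₀ hs0 hs_le 2
  have hs2_ge : x ^ 2 - x ^ 4 / 3 ≤ s ^ 2 := by
    have h := pow_le_pow_left₀ hlin hs_ge 2
    have h6 : 0 ≤ x ^ 6 := by positivity
    linarith
  have hxt : 9 / 20 ≤ x * t := by linarith
  have hxt' : x * t ≤ 9 / 10 := by linarith
  have hy : 81 / 400 ≤ (x * t) ^ 2 := by nlinarith
  have hy' : (x * t) ^ 2 ≤ 81 / 100 := by nlinarith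
  have ht2 : 0 < t ^ 2 := by positivity
  have hτ : 1 / t ^ 2 ≤ 1 / 4 := one_div_le_one_div_of_le (by norm_num) (by nlinarith)
  have hw : (s * t) ^ 2 ≤ (x * t) ^ 2 := by
    rw [mul_pow, mul_pow]; exact mul_le_mul_of_nonneg_right hs2_le ht2.le
  have hw' : (x * t) ^ 2 - ((x * t) ^ 2) ^ 2 * (1 / t ^ 2) / 3 ≤ (s * t) ^ 2 := by
    have h := mul_le_mul_of_nonneg_right hs2_ge ht2.le
    have heq : ((x * t) ^ 2) ^ 2 * (1 / t ^ 2) = x ^ 4 * t ^ 2 := by field_simp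
    rw [heq]
    linarith
  have hpoly := late_time_polynomial hy hy' (by positivity) hτ hw hw'
  have hz : (4 * t * s) ^ 2 ≤ 324 / 25 := by linarith
  have havg := average_sin_sq_mul_cos_le (n := L + 1) (by omega) x s (4 * t * s) hz
  have hcos := Real.taylor_six_le_cos (2 * x * t)
  have hτs : 1 / t ^ 2 * (s * t) ^ 2 = s ^ 2 := by field_simp
  have hcorr : 2 * (1 / t ^ 2) * ((s * t) ^ 2 * (1 - 4 * (s * t) ^ 2 + 4 * ((s * t) ^ 2) ^ 2
        - 16 / 9 * ((s * t) ^ 2) ^ 3))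
      = 2 * s ^ 2 * (1 - 4 * (s * t) ^ 2 + 4 * ((s * t) ^ 2) ^ 2
        - 16 / 9 * ((s * t) ^ 2) ^ 3) := by
    rw [← hτs]; ring
  rw [hcorr] at hpoly
  unfold momentum
  rw [Nat.cast_add, Nat.cast_one] at havg ⊢
  linarith

/-- The admissible range of `α t` has endpoints in ratio two, so that some multiple of
`π t / (L + 1)` falls into it; this fails only if the latter exceeds `9 / 5`, but `t ≤ L / 2` keeps it below
`π / 2`. -/
theorem exists_momentum_mul_mem {L : ℕ} {t : ℝ} (ht : 0 < t) (htL : t ≤ L / 2) :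
    ∃ k : ℕ, 9 / 10 ≤ momentum L k * t ∧ momentum L k * t ≤ 9 / 5 := by
  have hL0 : (0 : ℝ) < L + 1 := by positivity
  have hmul (k : ℕ) : momentum L k * t = k * (Real.pi * t / (L + 1)) := by
    unfold momentum; push_cast; ring
  set u := Real.pi * t / (L + 1) with hu
  have hu0 : 0 < u := by positivity
  have hu2 : u ≤ 9 / 5 := by
    rw [hu, div_le_iff₀ hL0]
    nlinarith [Real.pi_lt_d2, Real.pi_pos]
  rcases le_or_gt (9 / 10) u with h | h
  · exact ⟨1, by rw [hmul]; simpa using h, by rw [hmul]; simpa using hu2⟩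
  · refine ⟨⌈9 / 10 / u⌉₊, ?_, ?_⟩
    · rw [hmul, ← div_le_iff₀ hu0]
      exact Nat.le_ceil _
    · have h1 := (Nat.ceil_lt_add_one (div_nonneg (by norm_num) hu0.le : 0 ≤ 9 / 10 / u)).le
      have h2 := mul_le_mul_of_nonneg_right h1 hu0.le
      rw [hmul]
      rw [add_mul, div_mul_cancel₀ _ hu0.ne'] at h2
      linarith

/-! ### The measurement outcome -/

theorem sum_norm_sq_evolvedState (L : ℕ) (hL : 1 ≤ L) (t : ℝ) :
    ∑ l : Fin L, ‖evolvedState (lineHamiltonian L) t (firstVertexState L hL) l‖ ^ 2 = 1 := by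
  have h := sum_norm_sq_mul_cos L hL t 0
  have h2 := sum_sin_sq_equally_spaced 0 (show 2 ≤ L + 1 by omega)
  have h0 : momentum L 0 = 0 := by simp [momentum]
  rw [h0] at h
  simp only [zero_mul, Real.cos_zero, mul_one, zero_div, Real.sin_zero, mul_zero, sub_zero, ne_eq,
    OfNat.ofNat_ne_zero, not_false_eq_true, zero_pow] at h
  rw [h]
  unfold momentum
  rw [h2]
  push_cast
  field_simp

/-- Markov's inequality for the complement of the event `E`. -/
theorem one_sub_le_measureProb {n : ℕ} {ψ : Fin n → ℂ} (hψ : ∑ l, ‖ψ l‖ ^ 2 = 1)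
    (E : Set (Fin n)) {f : Fin n → ℝ} (hf : ∀ l, 0 ≤ f l) (hfE : ∀ l, l ∉ E → 1 ≤ f l) :
    1 - ∑ l, ‖ψ l‖ ^ 2 * f l ≤ measureProb ψ E := by
  rw [← hψ, ← Finset.sum_sub_distrib, measureProb]
  refine Finset.sum_le_sum fun l _ => ?_
  have h0 := sq_nonneg ‖ψ l‖
  split_ifs with hl
  · linarith [mul_nonneg h0 (hf l)]
  · linarith [mul_le_mul_of_nonneg_left (hfE l hl) h0]

theorem mainTheorem8 (L : ℕ) (hL : 1 ≤ L) (t : ℝ) (ht : t ∈ Set.Icc (0 : ℝ) ((L : ℝ) / 2)) :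
    (1 : ℝ) / 3 ≤
      measureProb (evolvedState (lineHamiltonian L) t (firstVertexState L hL))
        {j : Fin L | t < ((j : ℕ) : ℝ) + 1} := by
  obtain ⟨ht0, htL⟩ := ht
  have hψ := sum_norm_sq_evolvedState L hL t
  rcases lt_or_ge t 1 with h1 | h1
  -- Every label exceeds `t`, so that the event is certain.
  · have h := one_sub_le_measureProb hψ {j : Fin L | t < ((j : ℕ) : ℝ) + 1} (f := fun _ => 0)
      (fun _ => le_rfl) fun l hl => by
        have : (0 : ℝ) ≤ (l : ℕ) := by positivity
        exact absurd (show t < ((l : ℕ) : ℝ) + 1 by linarith) hl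
    simp only [mul_zero, Finset.sum_const_zero] at h
    linarith
  rcases lt_or_ge t 2 with h2 | h2
  -- Only the label `1` does not exceed `t`.
  · have hL2 : 2 ≤ L := by
      have : (2 : ℝ) ≤ L := by linarith
      exact_mod_cast this
    have h := one_sub_le_measureProb hψ {j : Fin L | t < ((j : ℕ) : ℝ) + 1}
      (f := Pi.single ⟨0, hL⟩ 1) (fun l => by
        rcases eq_or_ne l ⟨0, hL⟩ with rfl | hl
        · simp
        · simp [hl]) fun l hl => by
        have hl' : ((l : ℕ) : ℝ) + 1 ≤ t := not_lt.1 hl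
        have hl0 : (l : ℕ) < 1 := by
          have : ((l : ℕ) : ℝ) < 1 := by linarith
          exact_mod_cast this
        have : l = ⟨0, hL⟩ := Fin.ext (by simpa using hl0)
        simp [this]
    rw [Finset.sum_eq_single ⟨0, hL⟩ (fun l _ hl => by simp [hl]) (by simp), Pi.single_eq_same,
      mul_one, evolvedState_first, Complex.norm_real, Real.norm_eq_abs, sq_abs] at h
    linarith [returnAmplitude_sq_le hL2 h1 h2.le]
  have hL4 : 4 ≤ L := by
    have : (4 : ℝ) ≤ L := by linarith
    exact_mod_cast this
  obtain ⟨k, hk, hk'⟩ := exists_momentum_mul_mem (L := L) (by linarith) htL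
  set α := momentum L k with hα
  have hα0 : 0 ≤ α := by rw [hα]; unfold momentum; positivity
  have hαπ : α * t < Real.pi := by linarith [Real.pi_gt_three]
  have hden : 0 < 1 + Real.cos (α * t) := by
    have := Real.cos_lt_cos_of_nonneg_of_le_pi (by positivity) le_rfl
      hαπ
    rw [Real.cos_pi] at this
    linarith
  have hmarkov := one_sub_le_measureProb hψ {j : Fin L | t < ((j : ℕ) : ℝ) + 1}
    (f := fun l => (1 + Real.cos (α * ((l : ℕ) + 1))) / (1 + Real.cos (α * t)))
    (fun l => div_nonneg (by linarith [Real.neg_one_le_cos (α * ((l : ℕ) + 1))]) hden.le)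
    fun l hl => by
      have hl' : ((l : ℕ) : ℝ) + 1 ≤ t := not_lt.1 hl
      rw [le_div_iff₀ hden, one_mul]
      have := Real.cos_le_cos_of_nonneg_of_le_pi (x := α * ((l : ℕ) + 1)) (y := α * t)
        (by positivity) (by linarith) (mul_le_mul_of_nonneg_left hl' hα0)
      linarith
  have hE := sum_norm_sq_mul_cos L hL t k
  have hle := one_add_sum_le_of_late hL4 h2 hk hk'
  rw [← hE] at hle
  have hsum : ∑ l : Fin L, ‖evolvedState (lineHamiltonian L) t (firstVertexState L hL) l‖ ^ 2
        * ((1 + Real.cos (α * ((l : ℕ) + 1))) / (1 + Real.cos (α * t))) ≤ 2 / 3 := by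
    simp_rw [← mul_div_assoc]
    rw [← Finset.sum_div, div_le_iff₀ hden]
    simp_rw [mul_one_add]
    rw [Finset.sum_add_distrib, hψ]
    linarith
  linarith
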